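/- Let $n\ge 1$ and let $\mathrm{Part}(n)$ be the set of partitions of $\{1,\dots,n\}$, with $P_1\preceq P_2$ if $P_1$ is refined by $P_2$. Let $X_{1,n}\subseteq[0,1]^{\mathrm{Part}(n)}$ be the set of tuples $(c_P)$ such that $c_{P_1}=1$ whenever $P_1\prec P_2$ and $c_{P_2}>0$, and such that $c_P=0$ for the discrete partition $P=\{\{1\},\dots,\{n\}\}$. For $(c_P)\in X_{1,n}$ put $Q_{sing}=\{P: c_P>0\}$ and $Q_{curve}=\{P: c_P<1\}$. Let $C$ be a connected, reduced, Gorenstein proper curve of arithmetic genus $1$ over an algebraically closed field, with distinct smooth marked points $p_1,\dots,p_n$. A closed point $q\in C$ is an elliptic Gorenstein singularity if $\mathcal O_{C,q}$ is Gorenstein and $\delta(q)-m(q)+1=1$, where $\delta(q)$ is the delta invariant and $m(q)$ the number of branches; $\mathrm{lev}(q)$ is the partition of $\{1,\dots,n\}$ in which $a,b$ lie in the same block if and only if $p_a,p_b$ lie in the same connected component of the normalization of $C$ at $q$. A subcurve is a connected reduced closed subscheme; for a subcurve $Z$ of arithmetic genus $1$, $\mathrm{lev}(Z)$ is the partition in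 which $a,b$ lie in the same block if and only if $p_a,p_b$ lie in the same connected component of $(C\setminus Z)\cup\{p_1,\dots,p_n\}$. A $(c_P)$-stable family over a $\mathbb Z[1/6]$-scheme $S$ is a flat proper morphism of schemes $\pi:C\to S$ with $n$ sections $\sigma_1,\dots,\sigma_n$ with disjoint images, such that every geometric fiber $C_s$ is a connected, reduced, Gorenstein curve of arithmetic genus $1$ whose marked points $\sigma_i(s)$ are smooth points, and: 1. $\mathrm{lev}(q)\in Q_{sing}$ for each elliptic Gorenstein singularity $q\in C_s$; 2. $\mathrm{lev}(Z)\in Q_{curve}$ for each subcurve $Z\subseteq C_s$ of genus $1$; 3. $\mathrm{lev}(Z_1)\prec\mathrm{lev}(Z_2)$ for each proper inclusion $Z_1\subsetneq Z_2$ of subcurves of $C_s$ of genus $1$; 4. each irreducible component of the minimal genus one subcurve $Z_{min}$ of $C_s$ meets $\overline{C_s\setminus Z_{min}}\cup\{\sigma_1(s),\dots,\sigma_n(s)\}$. Let $\overline{\mathcal M}_{1,n}((c_P))$ be the stack over $\mathbb Z[1/6]$ whose objects over $S$ are the $(c_P)$-stable families over $S$ and whose morphisms are the cartesian squares compatible with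 the sections. **Theorem.** Suppose that $(c_P),(d_P)\in X_{1,n}$ and that $(d_P)$ lies in a face of the cube containing $(c_P)$, i.e. $d_P=c_P$ whenever $c_P=0$ or $c_P=1$. Then there is a fully faithful inclusion functor $$\overline{\mathcal M}_{1,n}((d_P))\hookrightarrow\overline{\mathcal M}_{1,n}((c_P)),$$ that is, a fully faithful functor over the category of $\mathbb Z[1/6]$-schemes which is the identity on the underlying families of pointed curves and on their morphisms. -/

import Mathlib

open CategoryTheory CategoryTheory.Limits AlgebraicGeometry TopologicalSpace

universe u

noncomputable section

namespace GenusOne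

/-! ### Partitions and the cube complex -/

/-- The partitions of an `n`-element set, ordered so that `P₁ ≤ P₂` if and only if `P₁` is refined
by `P₂`.  (Mathlib orders partitions with the finer one below, whence the order dual.) -/
abbrev Part (n : ℕ) : Type := (Finpartition (Finset.univ : Finset (Fin n)))ᵒᵈ

/-- The discrete partition `{{1}, …, {n}}`. -/
def Part.discrete (n : ℕ) : Part n :=
  OrderDual.toDual (⊥ : Finpartition (Finset.univ : Finset (Fin n)))

/-- The partition of the index set into the classes of an equivalence relation. -/
def Part.ofSetoid {n : ℕ} (r : Setoid (Fin n)) : Part n :=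
  letI : DecidableRel r.r := Classical.decRel _
  OrderDual.toDual (Finpartition.ofSetoid r)

/-- The set `X_{1,n}` of points of the cube complex inside `[0,1]^Part(n)`. -/
def cubeComplex (n : ℕ) : Set (Part n → ℝ) :=
  {c | (∀ P, c P ∈ Set.Icc (0 : ℝ) 1) ∧
    (∀ P₁ P₂ : Part n, P₁ < P₂ → 0 < c P₂ → c P₁ = 1) ∧
    c (Part.discrete n) = 0}

/-- The partitions allowed as levels of elliptic singularities. -/
def Qsing {n : ℕ} (c : Part n → ℝ) : Set (Part n) := {P | 0 < c P}

/-- The partitions allowed as levels of genus one subcurves. -/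
def Qcurve {n : ℕ} (c : Part n → ℝ) : Set (Part n) := {P | c P < 1}

/-! ### Local rings: Gorenstein rings, delta invariant, branches, genus of a singularity -/

/-- A Noetherian local ring is Gorenstein if it has finite injective dimension over itself. -/
def IsGorensteinLocalRing (R : Type u) [CommRing R] : Prop :=
  IsLocalRing R ∧ IsNoetherianRing R ∧
    ∃ d : ℕ, HasInjectiveDimensionLE (ModuleCat.of R R) d

/-- The normalization of a (reduced) ring: its integral closure in its total ring of fractions. -/
abbrev RingNormalization (R : Type u) [CommRing R] : Type u :=
  integralClosure R (FractionRing R)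

/-- The delta invariant: the length of the normalization modulo the ring.  At a closed point of a
curve over an algebraically closed field this is the dimension of the quotient over that field. -/
def deltaInvariant (R : Type u) [CommRing R] : ℕ∞ :=
  Module.length R
    (RingNormalization R ⧸ LinearMap.range (Algebra.linearMap R (RingNormalization R)))

/-- The number of branches: the number of points of the normalization over the closed point. -/
def numBranches (R : Type u) [CommRing R] : ℕ :=
  Nat.card (MaximalSpectrum (RingNormalization R))

/-- The genus `g = δ - m + 1` of a curve singularity with `m` branches. -/
def singularityGenus (R : Type u) [CommRing R] : ℤ :=
  ((deltaInvariant R).toNat : ℤ) - (numBranches R : ℤ) + 1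

/-! ### Coherent cohomology of the structure sheaf and the arithmetic genus -/

section Cohomology

variable {K : Type u} [Field K] {X : Scheme.{u}} (f : X ⟶ Spec (CommRingCat.of K))

/-- The structure map `K → Γ(X, U)` of a `K`-scheme. -/
def scalarMap (U : X.Opens) : CommRingCat.of K ⟶ Γ(X, U) :=
  (Scheme.ΓSpecIso (CommRingCat.of K)).inv ≫ f.appTop ≫ X.presheaf.map (homOfLE le_top).op

theorem scalarMap_map {U V : (Opens X)ᵒᵖ} (i : U ⟶ V) :
    scalarMap f U.unop ≫ X.presheaf.map i = scalarMap f V.unop := by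
  unfold scalarMap
  rw [Category.assoc, Category.assoc, ← Functor.map_comp]
  rfl

/-- The structure sheaf of a `K`-scheme as a presheaf of `K`-vector spaces. -/
def structurePresheaf : (Opens X)ᵒᵖ ⥤ ModuleCat.{u} K where
  obj U := (ModuleCat.restrictScalars (scalarMap f U.unop).hom).obj
    (ModuleCat.of Γ(X, U.unop) Γ(X, U.unop))
  map {U V} i := ModuleCat.ofHom
    (X := (ModuleCat.restrictScalars (scalarMap f U.unop).hom).obj
      (ModuleCat.of Γ(X, U.unop) Γ(X, U.unop)))
    (Y := (ModuleCat.restrictScalars (scalarMap f V.unop).hom).obj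
      (ModuleCat.of Γ(X, V.unop) Γ(X, V.unop)))
    { toFun := fun s => (X.presheaf.map i).hom s
      map_add' := fun s t => map_add (X.presheaf.map i).hom s t
      map_smul' := fun a s => by
        change (X.presheaf.map i).hom ((scalarMap f U.unop).hom a * (show Γ(X, U.unop) from s)) =
          (scalarMap f V.unop).hom a * (X.presheaf.map i).hom s
        rw [map_mul, ← scalarMap_map f i]
        rfl }
  map_id U := by
    ext s
    exact ConcreteCategory.congr_hom (X.presheaf.map_id U) s
  map_comp i j := by
    ext s
    exact ConcreteCategory.congr_hom (X.presheaf.map_comp i j) s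

/-- The structure sheaf of a `K`-scheme as a sheaf of `K`-vector spaces. -/
def structureSheaf : Sheaf (Opens.grothendieckTopology X) (ModuleCat.{u} K) where
  obj := structurePresheaf f
  property := by
    rw [Presheaf.isSheaf_iff_isSheaf_forget _ _ (forget (ModuleCat.{u} K))]
    exact (Presheaf.isSheaf_iff_isSheaf_forget _ _ (forget CommRingCat.{u})).1 X.sheaf.property

/-- The cohomology `H^i(X, 𝒪_X)`, as a `K`-vector space: the `Ext` groups from the constant sheaf
with value `K`, in the category of sheaves of `K`-vector spaces. -/
abbrev StructureCohomology (i : ℕ) : Type u :=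
  Abelian.Ext.{u} ((constantSheaf (Opens.grothendieckTopology X) (ModuleCat.{u} K)).obj
    (ModuleCat.of K K)) (structureSheaf f) i

/-- The arithmetic genus `1 - χ(𝒪_X) = 1 - h⁰(𝒪_X) + h¹(𝒪_X)` of a proper scheme of dimension at
most one over a field `K`. -/
def arithmeticGenus : ℤ :=
  1 - (Module.finrank K (StructureCohomology f 0) : ℤ)
    + (Module.finrank K (StructureCohomology f 1) : ℤ)

end Cohomology

/-! ### Proper pointed schemes over a field -/

/-- A proper scheme over a field `K` with `n` marked `K`-points. -/
structure PointedScheme (n : ℕ) (K : Type u) [Field K] where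
  /-- the scheme -/
  X : Scheme.{u}
  /-- the structure morphism -/
  str : X ⟶ Spec (CommRingCat.of K)
  /-- the marked points -/
  mark : Fin n → (Spec (CommRingCat.of K) ⟶ X)
  mark_str : ∀ i, mark i ≫ str = 𝟙 _
  proper : IsProper str

namespace PointedScheme

variable {n : ℕ} {K : Type u} [Field K] (C : PointedScheme n K)

/-- The point of the underlying space given by the `i`-th marking. -/
def pt (i : Fin n) : C.X := C.mark i (IsLocalRing.closedPoint K)

/-- The arithmetic genus of a closed subset with its reduced induced scheme structure. -/
def genusOfClosed (Z : Closeds C.X) : ℤ :=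
  arithmeticGenus ((Scheme.IdealSheafData.vanishingIdeal Z).subschemeι ≫ C.str)

/-- A connected subcurve of genus one.  Reduced closed subschemes are given by their underlying
closed subsets. -/
def IsGenusOneSubcurve (Z : Closeds C.X) : Prop :=
  _root_.IsConnected (Z : Set C.X) ∧ C.genusOfClosed Z = 1

/-- The level of a subcurve `Z`: two indices are in the same block if and only if the markings are
in the same connected component of `(C ∖ Z) ∪ Σ`, where `Σ` is the set of marked points. -/
def levCurve (Z : Closeds C.X) : Part n :=
  Part.ofSetoid (Setoid.ker fun i : Fin n =>
    connectedComponentIn ((Z : Set C.X)ᶜ ∪ Set.range C.pt) (C.pt i))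

/-- A closed point at which the local ring is Gorenstein and the singularity has genus one. -/
def IsEllipticGorenstein (q : C.X) : Prop :=
  IsClosed ({q} : Set C.X) ∧ IsGorensteinLocalRing (C.X.presheaf.stalk q) ∧
    singularityGenus (C.X.presheaf.stalk q) = 1

/-- The complement of a closed point. -/
def puncture (q : C.X) (hq : IsClosed ({q} : Set C.X)) : C.X.Opens :=
  ⟨{q}ᶜ, hq.isOpen_compl⟩

instance (U : C.X.Opens) : QuasiCompact U.ι := by
  have := C.proper
  have : IsLocallyNoetherian C.X := LocallyOfFiniteType.isLocallyNoetherian C.str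
  infer_instance

/-- The level of a closed point `q`: two indices are in the same block if and only if the markings
lie on the same connected component of the normalization of `C` at `q`.  The normalization at `q`
is the relative normalization of `C` in the open subscheme `C ∖ {q}`; on a reduced curve its
stalk over `q` is the integral closure of the local ring at `q` in its total ring of fractions, and
it is an isomorphism away from `q`, so that a marking different from `q` has exactly one
preimage. -/
def levSing (q : C.X) (hq : IsClosed ({q} : Set C.X)) : Part n :=
  Part.ofSetoid (Setoid.ker fun i : Fin n =>
    connectedComponent '' ((C.puncture q hq).ι.fromNormalization ⁻¹' {C.pt i}))

/-- Connected reduced Gorenstein curves of arithmetic genus one with `n` distinct smooth marked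
points. -/
structure IsGorensteinGenusOne : Prop where
  connected : ConnectedSpace C.X
  reduced : IsReduced C.X
  dim_one : topologicalKrullDim C.X = 1
  gorenstein : ∀ x : C.X, IsGorensteinLocalRing (C.X.presheaf.stalk x)
  genus_one : arithmeticGenus C.str = 1
  distinct : Function.Injective C.pt
  smooth : ∀ i, ∃ U : C.X.Opens, C.pt i ∈ U ∧ Smooth (U.ι ≫ C.str)

/-- The conditions that `(c_P)`-stability puts on a geometric fiber. -/
structure IsStable (c : Part n → ℝ) : Prop extends C.IsGorensteinGenusOne where
  level_sing : ∀ (q : C.X) (hq : C.IsEllipticGorenstein q), C.levSing q hq.1 ∈ Qsing c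
  level_curve : ∀ Z : Closeds C.X, C.IsGenusOneSubcurve Z → C.levCurve Z ∈ Qcurve c
  level_strict : ∀ Z₁ Z₂ : Closeds C.X, C.IsGenusOneSubcurve Z₁ → C.IsGenusOneSubcurve Z₂ →
    Z₁ < Z₂ → C.levCurve Z₁ < C.levCurve Z₂
  /-- Every irreducible component `F` of the minimal genus one subcurve `Z` meets the closure of
  the complement of `Z` or contains a marked point. -/
  component_meets : ∀ Z : Closeds C.X, Minimal C.IsGenusOneSubcurve Z →
    ∀ F : Set C.X, Maximal (fun T => IsIrreducible T ∧ T ⊆ (Z : Set C.X)) F →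
      (F ∩ (closure (Z : Set C.X)ᶜ ∪ Set.range C.pt)).Nonempty

end PointedScheme

/-! ### Families and the moduli categories -/

/-- The base `Spec ℤ[1/6]`. -/
def baseScheme : Scheme.{u} :=
  Spec (CommRingCat.of (ULift.{u} (Localization.Away (6 : ℤ))))

/-- A flat proper morphism of schemes over `Spec ℤ[1/6]` with `n` sections with disjoint images. -/
structure PointedFamily (n : ℕ) where
  /-- the base of the family -/
  S : Over baseScheme.{u}
  /-- the total space -/
  C : Scheme.{u}
  /-- the projection -/
  π : C ⟶ S.left
  /-- the sections -/
  σ : Fin n → (S.left ⟶ C)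
  σ_π : ∀ i, σ i ≫ π = 𝟙 S.left
  flat : Flat π
  proper : IsProper π
  disjoint : Pairwise fun i j => Disjoint (Set.range (σ i)) (Set.range (σ j))

namespace PointedFamily

variable {n : ℕ}

/-- Morphisms of families are cartesian squares compatible with the sections. -/
@[ext]
structure Hom (A B : PointedFamily.{u} n) where
  /-- the morphism of bases -/
  base : A.S ⟶ B.S
  /-- the morphism of total spaces -/
  total : A.C ⟶ B.C
  isPullback : IsPullback total A.π B.π base.left
  σ_comp : ∀ i, A.σ i ≫ total = base.left ≫ B.σ i

instance : Category (PointedFamily.{u} n) where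
  Hom := Hom
  id A :=
    { base := 𝟙 _
      total := 𝟙 _
      isPullback := IsPullback.of_id_fst
      σ_comp := by simp }
  comp {A B D} f g :=
    { base := f.base ≫ g.base
      total := f.total ≫ g.total
      isPullback := f.isPullback.paste_horiz g.isPullback
      σ_comp := fun i => by
        rw [← Category.assoc, f.σ_comp, Category.assoc, g.σ_comp, Over.comp_left,
          Category.assoc] }
  id_comp f := by apply Hom.ext <;> simp
  comp_id f := by apply Hom.ext <;> simp
  assoc f g h := by apply Hom.ext <;> simp

/-- The functor sending a family to its base. -/
def toBase (n : ℕ) : PointedFamily.{u} n ⥤ Over baseScheme.{u} where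
  obj A := A.S
  map f := f.base

/-- The fiber of a family over a geometric point `s : Spec K ⟶ S`. -/
def fiber (A : PointedFamily.{u} n) (K : Type u) [Field K]
    (s : Spec (CommRingCat.of K) ⟶ A.S.left) : PointedScheme n K where
  X := pullback A.π s
  str := pullback.snd A.π s
  mark i := pullback.lift (s ≫ A.σ i) (𝟙 _) (by
    rw [Category.assoc, A.σ_π, Category.comp_id, Category.id_comp])
  mark_str i := pullback.lift_snd _ _ _
  proper := by
    have := A.proper
    infer_instance

end PointedFamily

/-- The property of a family of being `(c_P)`-stable: a condition on all geometric fibers. -/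
def stable {n : ℕ} (c : Part n → ℝ) : ObjectProperty (PointedFamily.{u} n) := fun A =>
  ∀ (K : Type u) [Field K] [IsAlgClosed K] (s : Spec (CommRingCat.of K) ⟶ A.S.left),
    (A.fiber K s).IsStable c

/-- The inclusion of the `(c_P)`-stable families into the category of all `n`-pointed families. -/
abbrev underlyingFamily {n : ℕ} (c : Part n → ℝ) :
    (stable.{u} c).FullSubcategory ⥤ PointedFamily.{u} n :=
  (stable.{u} c).ι

/-- The moduli stack of `(c_P)`-stable curves, as a category over the category of schemes over
`Spec ℤ[1/6]`: its objects over `S` are the `(c_P)`-stable families over `S` and its morphisms are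
the cartesian squares compatible with the sections. -/
def Moduli {n : ℕ} (c : Part n → ℝ) : BasedCategory (Over baseScheme.{u}) :=
  BasedCategory.ofFunctor (underlyingFamily.{u} c ⋙ PointedFamily.toBase n)

end GenusOne

end

namespace GenusOne

/-! The parameters enter stability only through the two sets of allowed levels, and only as
conditions that certain levels belong to them; enlarging these sets therefore weakens the condition.
The face hypothesis gives exactly such an enlargement: the coordinates where `c` is `0` or `1` are
frozen in `d`, so a coordinate with `d P > 0` cannot have `c P = 0`, and one with `d P < 1` cannot
have `c P = 1`. Hence `Qsing d ⊆ Qsing c` and `Qcurve d ⊆ Qcurve c`, and every `d`-stable family is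
`c`-stable. Both moduli categories are full subcategories of the same category of pointed families,
so the inclusion between them is fully faithful. -/

/-- If `d` lies in a face of the cube containing `c`, then `d` allows no more singularities. -/
theorem Qsing_subset_of_face {n : ℕ} {c d : Part n → ℝ} (hc : c ∈ cubeComplex n)
    (hface : ∀ P, c P = 0 ∨ c P = 1 → d P = c P) : Qsing d ⊆ Qsing c := by
  intro P (hP : 0 < d P)
  -- Membership in the cube gives `0 ≤ c P`, so only `c P = 0` has to be excluded; there the face
  -- condition would give `d P = 0`.
  refine (hc.1 P).1.lt_of_ne' fun h => ?_
  rw [hface P (Or.inl h), h] at hP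
  exact lt_irrefl _ hP

/-- If `d` lies in a face of the cube containing `c`, then `d` allows no more genus one
subcurves. -/
theorem Qcurve_subset_of_face {n : ℕ} {c d : Part n → ℝ} (hc : c ∈ cubeComplex n)
    (hface : ∀ P, c P = 0 ∨ c P = 1 → d P = c P) : Qcurve d ⊆ Qcurve c := by
  intro P (hP : d P < 1)
  refine (hc.1 P).2.lt_of_ne fun h => ?_
  rw [hface P (Or.inr h), h] at hP
  exact lt_irrefl _ hP

/-- Stability of a pointed curve is monotone in the sets of allowed levels. -/
theorem PointedScheme.IsStable.mono {n : ℕ} {K : Type u} [Field K] {C : PointedScheme n K}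
    {c d : Part n → ℝ} (hsing : Qsing d ⊆ Qsing c) (hcurve : Qcurve d ⊆ Qcurve c)
    (h : C.IsStable d) : C.IsStable c where
  toIsGorensteinGenusOne := h.toIsGorensteinGenusOne
  level_sing q hq := hsing (h.level_sing q hq)
  level_curve Z hZ := hcurve (h.level_curve Z hZ)
  -- This condition and the next involve only the geometry of the fiber, not the parameters, so they
  -- transfer verbatim.
  level_strict := h.level_strict
  component_meets := h.component_meets

/-- Stability of a family is monotone in the sets of allowed levels. -/
theorem stable_le_stable {n : ℕ} {c d : Part n → ℝ} (hsing : Qsing d ⊆ Qsing c)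
    (hcurve : Qcurve d ⊆ Qcurve c) : stable.{u} d ≤ stable.{u} c :=
  fun _ hA K _ _ s => (hA K s).mono hsing hcurve

/-- The inclusion of moduli categories induced by an implication between stability conditions. -/
noncomputable def Moduli.inclusion {n : ℕ} {c d : Part n → ℝ} (h : stable.{u} d ≤ stable.{u} c) :
    BasedFunctor (Moduli.{u} d) (Moduli.{u} c) where
  toFunctor := ObjectProperty.ιOfLE h
  -- The inclusion changes only the proof of stability attached to a family, so the projections to
  -- the base agree definitionally.
  w := rfl

end GenusOne

/-- The last conjunct is a strict equality of functors: it pins `F` down as the identity on families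
and their morphisms, which full faithfulness alone would not do. -/
theorem mainTheorem9 (n : ℕ) (hn : 0 < n) (c d : GenusOne.Part n → ℝ)
    (hc : c ∈ GenusOne.cubeComplex n) (hd : d ∈ GenusOne.cubeComplex n)
    (hface : ∀ P, c P = 0 ∨ c P = 1 → d P = c P) :
    ∃ F : CategoryTheory.BasedFunctor (GenusOne.Moduli.{u} d) (GenusOne.Moduli.{u} c),
      F.toFunctor.Full ∧ F.toFunctor.Faithful ∧
        F.toFunctor ⋙ GenusOne.underlyingFamily.{u} c = GenusOne.underlyingFamily.{u} d := by
  have h := GenusOne.stable_le_stable.{u} (GenusOne.Qsing_subset_of_face hc hface)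
    (GenusOne.Qcurve_subset_of_face hc hface)
  -- Instance search does not see through the based-category wrapper, so the instances are stated
  -- for the underlying inclusion of full subcategories.
  exact ⟨GenusOne.Moduli.inclusion h, inferInstanceAs (ObjectProperty.ιOfLE h).Full,
    inferInstanceAs (ObjectProperty.ιOfLE h).Faithful, rfl⟩
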